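/- Let $H=\frac{1}{\sqrt2}\begin{pmatrix}1&1\\1&-1\end{pmatrix}$ and, for $N=2^k$ with $k\ge 1$, let $Z_N=\mathrm{diag}(1,e^{i\pi/N})$, an $N$-th root of the Pauli gate $Z$ (so $Z_2=S$ and $Z_4=T$). A Clifford+$Z_N$ circuit on $n$ qubits is a finite sequence of gates, each of which is a Hadamard gate $H$, a CNOT gate, or a phase gate $Z_N$ or $Z_N^\dagger$ with $N=2^k$ for some $k\ge1$, where $N$ may differ from gate to gate; the circuit is ancilla-free in that it acts on these $n$ qubits only. Its phase depth is the minimum number of cycles in which all its phase gates ($S$ and $T$ included) can be executed: in one cycle, phase gates on distinct qubits are executed in parallel, the Hadamard and CNOT gates are executed between the cycles at no cost, and gates that share a qubit are executed in the order of the circuit. The $n$-MCT gate is the unitary on $n$ qubits with $|c_1,\dots,c_{n-1},c_n\rangle\mapsto|c_1,\dots,c_{n-1},c_n\oplus c_1c_2\cdots c_{n-1}\rangle$. For every $n\ge4$ there is an ancilla-free Clifford+$Z_N$ circuit on $n$ qubits whose unitary is exactly the $n$-MCT gate and whose phase depth is $7$ if $n=4$, $13$ if $n=5$, and $4n-6$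 if $n\ge6$. In particular, the $n$-MCT gate has an ancilla-free exact decomposition over the Clifford+$Z_N$ library with phase depth $O(n)$. -/

import Mathlib

noncomputable section

namespace CliffordZN

/-- Computational basis states of `n` qubits. The addition and multiplication of `Fin 2`
are XOR and AND. -/
abbrev Basis (n : ℕ) : Type := Fin n → Fin 2

/-- Operators on the state space of `n` qubits; the entry at `(x, y)` is `⟨x| U |y⟩`. -/
abbrev Op (n : ℕ) : Type := Matrix (Basis n) (Basis n) ℂ

/-- The one-qubit operator `U` on qubit `q`, tensored with the identity on the other qubits. -/
def onQubit {n : ℕ} (U : Matrix (Fin 2) (Fin 2) ℂ) (q : Fin n) : Op n :=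
  fun x y => if ∀ j, j ≠ q → x j = y j then U (x q) (y q) else 0

/-- The operator `|y⟩ ↦ |f y⟩`. -/
def ofBasisMap {n : ℕ} (f : Basis n → Basis n) : Op n :=
  fun x y => if x = f y then 1 else 0

/-- The Hadamard matrix. -/
def hadamard : Matrix (Fin 2) (Fin 2) ℂ :=
  ((1 / Real.sqrt 2 : ℝ) : ℂ) • !![1, 1; 1, -1]

/-- The `N`-th root `Z_N = diag (1, exp (i π / N))` of the Pauli matrix `Z`. -/
def zRoot (N : ℕ) : Matrix (Fin 2) (Fin 2) ℂ :=
  !![1, 0; 0, Complex.exp (Complex.I * Real.pi / N)]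

/-- The gate library on `n` qubits: Hadamard gates, CNOT gates, and the phase gates `Z_N` and
`Z_N†` for `N = 2 ^ k`, `k ≥ 1`. The gates `S = Z_2` and `T = Z_4` are among the latter. -/
inductive Gate (n : ℕ) : Type
  | H (q : Fin n)
  | CNOT (c t : Fin n) (h : c ≠ t)
  | Z (k : ℕ) (hk : 1 ≤ k) (q : Fin n)
  | Zdag (k : ℕ) (hk : 1 ≤ k) (q : Fin n)

namespace Gate

variable {n : ℕ}

/-- The unitary operator of a gate. -/
def toOp : Gate n → Op n
  | H q => onQubit hadamard q
  | CNOT c t _ => ofBasisMap fun y => Function.update y t (y t + y c)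
  | Z k _ q => onQubit (zRoot (2 ^ k)) q
  | Zdag k _ q => onQubit (zRoot (2 ^ k)).conjTranspose q

/-- The qubits on which a gate acts. -/
def support : Gate n → Finset (Fin n)
  | H q => {q}
  | CNOT c t _ => {c, t}
  | Z _ _ q => {q}
  | Zdag _ _ q => {q}

/-- The number of phase cycles that a gate takes: one for every phase gate `Z_N` or `Z_N†`
(including `S` and `T`), none for the Hadamard and CNOT gates. -/
def phaseCost : Gate n → ℕ
  | H _ => 0
  | CNOT _ _ _ => 0
  | Z _ _ _ => 1
  | Zdag _ _ _ => 1

end Gate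

/-- A circuit on exactly `n` qubits (so without ancillas): the list of its gates, in the order
in which they are applied. -/
abbrev Circuit (n : ℕ) : Type := List (Gate n)

namespace Circuit

variable {n : ℕ}

/-- The operator of a circuit; the head of the list acts first. -/
def toOp : Circuit n → Op n
  | [] => 1
  | g :: C => toOp C * g.toOp

/-- `τ` executes the circuit `C` in the phase cycles `1, …, d`. A phase gate `i` is executed in
cycle `τ i`; a gate `i` that is not a phase gate is executed after cycle `τ i` and before cycle
`τ i + 1`. Gates that act on a common qubit are executed in their order in `C`; in particular
no cycle holds two phase gates on the same qubit. -/
structure IsSchedule (C : Circuit n) (d : ℕ) (τ : Fin C.length → ℕ) : Prop where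
  start : ∀ i, (C.get i).phaseCost ≤ τ i
  finish : ∀ i, τ i ≤ d
  order : ∀ i j, i < j → ¬ Disjoint (C.get i).support (C.get j).support →
    τ i + (C.get j).phaseCost ≤ τ j

/-- The phase depth of a circuit: the minimum number of cycles in which all its phase gates can
be executed. -/
def phaseDepth (C : Circuit n) : ℕ :=
  sInf {d | ∃ τ : Fin C.length → ℕ, IsSchedule C d τ}

/-- Every circuit has a schedule, so that the infimum above is a minimum. -/
theorem exists_isSchedule (C : Circuit n) :
    ∃ (d : ℕ) (τ : Fin C.length → ℕ), IsSchedule C d τ := by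
  have hc : ∀ g : Gate n, g.phaseCost ≤ 1 := by
    intro g; cases g <;> simp [Gate.phaseCost]
  refine ⟨C.length, fun i => i.1 + 1, ⟨fun i => ?_, fun i => i.2, fun i j hij _ => ?_⟩⟩
  · exact (hc _).trans (Nat.le_add_left 1 _)
  · have h1 := hc (C.get j)
    have h2 : i.1 < j.1 := hij
    show i.1 + 1 + (C.get j).phaseCost ≤ j.1 + 1
    omega

end Circuit

/-- The multi-controlled Toffoli gate on `n` qubits with target `t`, whose controls are all the
other qubits: it replaces the bit of `t` by its XOR with the product of the control bits. -/
def mct {n : ℕ} (t : Fin n) : Op n :=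
  ofBasisMap fun y => Function.update y t (y t + ∏ j ∈ Finset.univ.erase t, y j)

end CliffordZN

end

/-!
For `n = 4, 5`, conjugation by a Hadamard gate on the target turns the gate into the phase
`(-1) ^ (∏ y)`, and `2 ^ (n - 1) ∏ y` is the alternating sum of the parities of all nonempty sets of
bits of `y`. A linear feedback shift register of maximal period runs through all these parities,
and CNOT gates produce `n` consecutive ones of them on the `n` qubits; each such batch is one cycle.

For `n ≥ 6`, let `inc j` be the increment modulo `2 ^ j` of the qubits `1, …, j`, controlled by
qubit `0`. The carry into the last qubit is the product of all other bits, so the gate is the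
quotient of `inc (n - 1)` by `inc (n - 2)`. The quantum Fourier transform turns an increment into
phases, a product of two bits is half of their sum minus their parity, and the parities of one
Fourier stage are available at the same time. What is not a parity commutes to one side of the
transform: a phase of the targets commutes with the phases of the increment, and what is left is
made the same for both increments by extra phase gates on qubits that are idle during the stages of
the longer transform; it does not involve the last qubit, hence commutes with the gate.

A shorter schedule is stretched to the prescribed depth by replacing a phase gate by two copies of
its square root again and again: this raises the depth by at most one each time, and without bound.
-/

noncomputable section

namespace CliffordZN

variable {n : ℕ}

/-! ### Schedules -/

namespace Circuit

/-- The cycles of a schedule, recorded next to the gates: `T` lists the gates of a circuit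
together with the cycle in which each is executed. Unlike `IsSchedule`, this form is stable under
list operations. -/
structure IsTimed (d : ℕ) (T : List (Gate n × ℕ)) : Prop where
  cost_le : ∀ a ∈ T, a.1.phaseCost ≤ a.2
  le_depth : ∀ a ∈ T, a.2 ≤ d
  order : T.Pairwise fun a b => ¬ Disjoint a.1.support b.1.support → a.2 + b.1.phaseCost ≤ b.2

/-- The circuit `C` can be executed in `d` phase cycles. -/
def Executable (C : Circuit n) (d : ℕ) : Prop :=
  ∃ T : List (Gate n × ℕ), T.map Prod.fst = C ∧ IsTimed d T

theorem executable_iff_exists_isSchedule {C : Circuit n} {d : ℕ} :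
    C.Executable d ↔ ∃ τ : Fin C.length → ℕ, IsSchedule C d τ := by
  constructor
  · rintro ⟨T, rfl, h⟩
    have hlen : (T.map Prod.fst).length = T.length := List.length_map _
    refine ⟨fun i => (T.get (i.cast hlen)).2, fun i => ?_, fun i => ?_, fun i j hij => ?_⟩
    · simpa using h.cost_le _ (T.get_mem (i.cast hlen))
    · exact h.le_depth _ (T.get_mem (i.cast hlen))
    · simpa using List.pairwise_iff_get.1 h.order (i.cast hlen) (j.cast hlen) hij
  · rintro ⟨τ, h⟩
    refine ⟨List.ofFn fun i => (C.get i, τ i), ?_, ?_, ?_, ?_⟩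
    · simp [List.map_ofFn, Function.comp_def]
    · simpa [List.mem_ofFn'] using h.start
    · simpa [List.mem_ofFn'] using h.finish
    · rw [List.pairwise_ofFn]
      exact fun i j hij => h.order i j hij

theorem phaseDepth_eq_sInf (C : Circuit n) : C.phaseDepth = sInf {d | C.Executable d} := by
  simp only [phaseDepth, executable_iff_exists_isSchedule]

theorem executable_phaseDepth (C : Circuit n) : C.Executable C.phaseDepth := by
  rw [phaseDepth_eq_sInf]
  obtain ⟨d, hd⟩ := exists_isSchedule C
  exact Nat.sInf_mem (s := {d | C.Executable d}) ⟨d, executable_iff_exists_isSchedule.2 hd⟩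

theorem Executable.phaseDepth_le {C : Circuit n} {d : ℕ} (h : C.Executable d) :
    C.phaseDepth ≤ d := by
  rw [phaseDepth_eq_sInf]
  exact Nat.sInf_le h

theorem Executable.mono {C : Circuit n} {d e : ℕ} (h : C.Executable d) (hde : d ≤ e) :
    C.Executable e := by
  obtain ⟨T, hT, hcost, hdepth, horder⟩ := h
  exact ⟨T, hT, hcost, fun a ha => (hdepth a ha).trans hde, horder⟩

theorem Executable.append {C D : Circuit n} {d e : ℕ} (hC : C.Executable d)
    (hD : D.Executable e) : Executable (C ++ D) (d + e) := by
  obtain ⟨T, rfl, hT⟩ := hC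
  obtain ⟨T', rfl, hT'⟩ := hD
  refine ⟨T ++ T'.map fun a => (a.1, d + a.2), by simp [Function.comp_def], ?_, ?_, ?_⟩
  · simp only [List.forall_mem_append, List.forall_mem_map]
    exact ⟨hT.cost_le, fun a ha => (hT'.cost_le a ha).trans (Nat.le_add_left _ _)⟩
  · simp only [List.forall_mem_append, List.forall_mem_map]
    exact ⟨fun a ha => (hT.le_depth a ha).trans (Nat.le_add_right _ _),
      fun a ha => Nat.add_le_add_left (hT'.le_depth a ha) d⟩
  · simp only [List.pairwise_append, List.pairwise_map, List.forall_mem_map]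
    refine ⟨hT.order, hT'.order.imp fun h hd => ?_, fun a ha b hb _ => ?_⟩
    · rw [add_assoc]
      exact Nat.add_le_add_left (h hd) d
    · exact Nat.add_le_add (hT.le_depth a ha) (hT'.cost_le b hb)

theorem executable_zero {C : Circuit n} (h : ∀ g ∈ C, g.phaseCost = 0) : C.Executable 0 := by
  refine ⟨C.map fun g => (g, 0), by simp [Function.comp_def], ?_, ?_, ?_⟩
  · simpa using h
  · simp
  · rw [List.pairwise_map]
    exact List.pairwise_of_forall_mem_list fun a _ b hb _ => by simp [h b hb]

end Circuit

theorem Gate.phaseCost_le_one (g : Gate n) : g.phaseCost ≤ 1 := by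
  cases g <;> simp [Gate.phaseCost]

namespace Circuit

theorem executable_one {C : Circuit n}
    (h : C.Pairwise fun g g' => Disjoint g.support g'.support) : C.Executable 1 := by
  refine ⟨C.map fun g => (g, 1), by simp [Function.comp_def], ?_, ?_, ?_⟩
  · simpa using fun g _ => g.phaseCost_le_one
  · simp
  · rw [List.pairwise_map]
    exact h.imp fun hd hnd => absurd hd hnd

theorem Executable.sublist {C C' : Circuit n} {d : ℕ} (h : C.Executable d)
    (hsub : List.Sublist C' C) : C'.Executable d := by
  obtain ⟨T, rfl, hT⟩ := h
  obtain ⟨T', hT', rfl⟩ := List.sublist_map_iff.1 hsub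
  exact ⟨T', rfl, fun a ha => hT.cost_le a (hT'.subset ha),
    fun a ha => hT.le_depth a (hT'.subset ha), hT.order.sublist hT'⟩

theorem Executable.length_le {C : Circuit n} {d : ℕ} (h : C.Executable d) (q : Fin n)
    (hq : ∀ g ∈ C, q ∈ g.support ∧ g.phaseCost = 1) : C.length ≤ d := by
  obtain ⟨T, rfl, hT⟩ := h
  rw [List.forall_mem_map] at hq
  have hlt : (T.map Prod.snd).Pairwise (· < ·) := by
    refine List.pairwise_map.2 (hT.order.imp_of_mem fun {a b} ha hb hab => ?_)
    have := hab (Finset.not_disjoint_iff.2 ⟨q, (hq a ha).1, (hq b hb).1⟩)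
    have := (hq b hb).2
    omega
  have hIcc : (T.map Prod.snd).toFinset ⊆ Finset.Icc 1 d := by
    simp only [Finset.subset_iff, List.mem_toFinset, List.forall_mem_map, Finset.mem_Icc]
    exact fun a ha => ⟨(hq a ha).2.symm.le.trans (hT.cost_le a ha), hT.le_depth a ha⟩
  simpa [List.toFinset_card_of_nodup (hlt.imp ne_of_lt)] using Finset.card_le_card hIcc

theorem Executable.split_phase {A B : Circuit n} {g g₁ g₂ : Gate n} {d : ℕ}
    (h : Executable (A ++ g :: B) d) (hs₁ : g₁.support = g.support) (hs₂ : g₂.support = g.support)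
    (hg : g.phaseCost = 1) (hg₁ : g₁.phaseCost = 1) (hg₂ : g₂.phaseCost = 1) :
    Executable (A ++ g₁ :: g₂ :: B) (d + 1) := by
  obtain ⟨T, hT, hcost, hdepth, horder⟩ := h
  obtain ⟨TA, T', rfl, rfl, hT'⟩ := List.map_eq_append_iff.1 hT
  obtain ⟨⟨a, t⟩, TB, rfl, rfl, rfl⟩ := List.map_eq_cons_iff.1 hT'
  simp only [List.forall_mem_append, List.forall_mem_cons, List.pairwise_append,
    List.pairwise_cons] at hcost hdepth horder hs₁ hs₂ hg
  obtain ⟨hA, ⟨haB, hB⟩, hAB⟩ := horder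
  refine ⟨TA ++ (g₁, t) :: (g₂, t + 1) :: TB.map fun b => (b.1, b.2 + 1), ?_, ?_, ?_, ?_⟩
  · simp [Function.comp_def]
  · simp only [List.forall_mem_append, List.forall_mem_cons, List.forall_mem_map]
    exact ⟨hcost.1, by omega, by omega, fun b hb => (hcost.2.2 b hb).trans (Nat.le_succ _)⟩
  · simp only [List.forall_mem_append, List.forall_mem_cons, List.forall_mem_map]
    exact ⟨fun a ha => (hdepth.1 a ha).trans (Nat.le_succ d), by omega, by omega,
      fun b hb => Nat.succ_le_succ (hdepth.2.2 b hb)⟩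
  · simp only [List.pairwise_append, List.pairwise_cons, List.pairwise_map, List.forall_mem_map,
      List.forall_mem_cons, hs₁, hs₂, hg₁, hg₂, hg] at hAB ⊢
    refine ⟨hA, ⟨⟨fun _ => le_rfl, fun b hb hd => ?_⟩, fun b hb hd => ?_, hB.imp ?_⟩,
      fun x hx => ⟨(hAB x hx).1, fun hd => ?_, fun b hb hd => ?_⟩⟩ <;> grind

end Circuit

/-! ### Phases and the exact depth -/

/-- The diagonal operator `|y⟩ ↦ exp (i π g(y)) |y⟩`. -/
def phase (g : Basis n → ℝ) : Op n :=
  Matrix.diagonal fun y => Complex.exp (Complex.I * Real.pi * (g y : ℂ))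

theorem phase_add (g h : Basis n → ℝ) : phase (g + h) = phase g * phase h := by
  simp only [phase, Matrix.diagonal_mul_diagonal, ← Complex.exp_add, Pi.add_apply,
    Complex.ofReal_add, mul_add]

theorem phase_zero : phase (0 : Basis n → ℝ) = 1 := by
  simp [phase]

theorem phase_neg (g : Basis n → ℝ) : phase (-g) = (phase g)⁻¹ :=
  (Matrix.inv_eq_left_inv (by rw [← phase_add, neg_add_cancel, phase_zero])).symm

theorem isUnit_phase (g : Basis n → ℝ) : IsUnit (phase g) :=
  .of_mul_eq_one (phase (-g)) (by rw [← phase_add, add_neg_cancel, phase_zero])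

theorem commute_phase_phase (g h : Basis n → ℝ) : Commute (phase g) (phase h) := by
  rw [Commute, SemiconjBy, ← phase_add, add_comm, phase_add]

/-- The bit of qubit `q` as a real-valued function of the basis state. -/
def bit (q : Fin n) (y : Basis n) : ℝ := ((y q).val : ℝ)

/-- The parity of the bits of qubits `p` and `q` as a real-valued function of the basis state. -/
def xorBit (p q : Fin n) (y : Basis n) : ℝ := ((y p + y q).val : ℝ)

theorem val_add_eq (u v : Fin 2) : ((u + v).val : ℝ) = u.val + v.val - 2 * (u.val * v.val) := by
  fin_cases u <;> fin_cases v <;> (simp; try norm_num)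

theorem val_mul_eq (u v : Fin 2) : ((u * v).val : ℝ) = u.val * v.val := by
  fin_cases u <;> fin_cases v <;> simp

theorem bit_mul_bit (p q : Fin n) :
    bit p * bit q = (1 / 2 : ℝ) • (bit p + bit q - xorBit p q) := by
  funext y
  simp only [Pi.mul_apply, Pi.smul_apply, Pi.sub_apply, Pi.add_apply, smul_eq_mul, bit, xorBit,
    val_add_eq]
  ring

theorem onQubit_diagonal (q : Fin n) (a : ℝ) :
    onQubit (Matrix.diagonal ![1, Complex.exp (Complex.I * Real.pi * (a : ℂ))]) q =
      phase (a • bit q) := by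
  ext x y
  by_cases hxy : x = y
  · subst hxy
    simp only [onQubit, phase, Matrix.diagonal_apply, implies_true, if_true, Pi.smul_apply, bit]
    generalize x q = u
    fin_cases u <;> simp
  · simp only [onQubit, phase, Matrix.diagonal_apply_ne _ hxy, ite_eq_right_iff]
    refine fun h => Matrix.diagonal_apply_ne _ fun hq => hxy (funext fun j => ?_)
    by_cases hj : j = q
    · exact hj ▸ hq
    · exact h j hj

theorem zRoot_two_pow (k : ℕ) : zRoot (2 ^ k) =
    Matrix.diagonal ![1, Complex.exp (Complex.I * Real.pi * (((2 ^ k : ℝ)⁻¹ : ℝ) : ℂ))] := by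
  ext i j
  fin_cases i <;> fin_cases j <;> simp [zRoot, div_eq_mul_inv]

namespace Gate

theorem toOp_Z (k : ℕ) (hk : 1 ≤ k) (q : Fin n) :
    (Z k hk q).toOp = phase ((2 ^ k : ℝ)⁻¹ • bit q) := by
  rw [toOp, zRoot_two_pow, onQubit_diagonal]

theorem toOp_Zdag (k : ℕ) (hk : 1 ≤ k) (q : Fin n) :
    (Zdag k hk q).toOp = phase (-(2 ^ k : ℝ)⁻¹ • bit q) := by
  rw [toOp, zRoot_two_pow, Matrix.diagonal_conjTranspose, ← onQubit_diagonal]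
  congr 2
  ext i
  fin_cases i <;> simp [← Complex.exp_conj, Complex.conj_ofNat]

/-- A square root of a phase gate in the gate library. The Hadamard and CNOT gates are left as
they are. -/
def sqrt : Gate n → Gate n
  | H q => H q
  | CNOT c t h => CNOT c t h
  | Z k hk q => Z (k + 1) (hk.trans k.le_succ) q
  | Zdag k hk q => Zdag (k + 1) (hk.trans k.le_succ) q

theorem support_sqrt (g : Gate n) : g.sqrt.support = g.support := by
  cases g <;> rfl

theorem phaseCost_sqrt (g : Gate n) : g.sqrt.phaseCost = g.phaseCost := by
  cases g <;> rfl

theorem toOp_sqrt_mul_toOp_sqrt {g : Gate n} (hg : g.phaseCost = 1) :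
    g.sqrt.toOp * g.sqrt.toOp = g.toOp := by
  have hhalf (k : ℕ) : (2 ^ (k + 1) : ℝ)⁻¹ + (2 ^ (k + 1) : ℝ)⁻¹ = (2 ^ k : ℝ)⁻¹ := by
    rw [pow_succ, mul_inv]
    ring
  cases g with
  | H q => simp [phaseCost] at hg
  | CNOT c t h => simp [phaseCost] at hg
  | Z k hk q => rw [sqrt, toOp_Z, toOp_Z, ← phase_add, ← add_smul, hhalf]
  | Zdag k hk q => rw [sqrt, toOp_Zdag, toOp_Zdag, ← phase_add, ← add_smul, ← neg_add, hhalf]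

theorem exists_support_eq_singleton {g : Gate n} (hg : g.phaseCost = 1) :
    ∃ q, g.support = {q} := by
  cases g with
  | H q => exact ⟨q, rfl⟩
  | CNOT c t h => simp [phaseCost] at hg
  | Z k hk q => exact ⟨q, rfl⟩
  | Zdag k hk q => exact ⟨q, rfl⟩

/-- The phase gate `g` as a product of `m + 1` phase gates, obtained by replacing the first gate
`m` times by two copies of its square root. -/
def split (g : Gate n) : ℕ → Circuit n
  | 0 => [g]
  | m + 1 => split g.sqrt m ++ [g.sqrt]

theorem length_split (g : Gate n) (m : ℕ) : (g.split m).length = m + 1 := by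
  induction m generalizing g with
  | zero => rfl
  | succ m ih => rw [split, List.length_append, ih, List.length_singleton]

theorem eq_of_mem_split {g g' : Gate n} {m : ℕ} (h : g' ∈ g.split m) :
    g'.support = g.support ∧ g'.phaseCost = g.phaseCost := by
  induction m generalizing g with
  | zero => simp_all [split]
  | succ m ih =>
    rcases List.mem_append.1 h with h | h
    · rw [← g.support_sqrt, ← g.phaseCost_sqrt]
      exact ih h
    · rw [List.mem_singleton.1 h]
      exact ⟨g.support_sqrt, g.phaseCost_sqrt⟩

end Gate

theorem exists_apply_eq_of_succ_le {f : ℕ → ℕ} {D : ℕ} (hzero : f 0 ≤ D)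
    (hsucc : ∀ m, f (m + 1) ≤ f m + 1) (hle : ∀ m, m ≤ f m) : ∃ m, f m = D := by
  have hex : ∃ m, D ≤ f m := ⟨D, hle D⟩
  refine ⟨Nat.find hex, le_antisymm ?_ (Nat.find_spec hex)⟩
  rcases hm : Nat.find hex with _ | m
  · exact hzero
  · have hlt : f m < D := not_le.1 (Nat.find_min hex (hm ▸ m.lt_succ_self))
    exact (hsucc m).trans hlt

namespace Circuit

theorem toOp_append (C D : Circuit n) : toOp (C ++ D) = toOp D * toOp C := by
  induction C with
  | nil => rw [List.nil_append, toOp, mul_one]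
  | cons g C ih => rw [List.cons_append, toOp, ih, toOp, mul_assoc]

theorem toOp_singleton (g : Gate n) : toOp [g] = g.toOp := by
  rw [toOp, toOp, one_mul]

theorem toOp_split {g : Gate n} (hg : g.phaseCost = 1) (m : ℕ) : toOp (g.split m) = g.toOp := by
  induction m generalizing g with
  | zero => exact toOp_singleton g
  | succ m ih =>
    rw [Gate.split, toOp_append, ih (g.phaseCost_sqrt.trans hg), toOp_singleton,
      Gate.toOp_sqrt_mul_toOp_sqrt hg]

theorem Executable.split_succ {A B : Circuit n} {g : Gate n} {d m : ℕ} (hg : g.phaseCost = 1)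
    (h : Executable (A ++ (g.split m ++ B)) d) :
    Executable (A ++ (g.split (m + 1) ++ B)) (d + 1) := by
  have hs := g.phaseCost_sqrt.trans hg
  induction m generalizing g B with
  | zero => exact h.split_phase g.support_sqrt g.support_sqrt hg hs hs
  | succ m ih =>
    rw [Gate.split, List.append_assoc] at h ⊢
    exact ih hs h (g.sqrt.phaseCost_sqrt.trans hs)

theorem Executable.exists_phaseDepth_eq_of_mem {C : Circuit n} {g : Gate n} {d D : ℕ}
    (h : C.Executable d) (hd : d ≤ D) (hgC : g ∈ C) (hg : g.phaseCost = 1) :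
    ∃ C' : Circuit n, C'.toOp = C.toOp ∧ C'.phaseDepth = D := by
  obtain ⟨A, B, rfl⟩ := List.append_of_mem hgC
  obtain ⟨q, hq⟩ := Gate.exists_support_eq_singleton hg
  obtain ⟨m, hm⟩ := exists_apply_eq_of_succ_le
    (f := fun m => phaseDepth (A ++ (g.split m ++ B))) (h.phaseDepth_le.trans hd)
    (fun m => ((executable_phaseDepth _).split_succ hg).phaseDepth_le) fun m => by
      have hsub : List.Sublist (g.split m) (A ++ (g.split m ++ B)) :=
        (List.sublist_append_left _ _).trans (List.sublist_append_right _ _)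
      have := ((executable_phaseDepth _).sublist hsub).length_le q fun g' hg' => by
        obtain ⟨hsupp, hcost⟩ := Gate.eq_of_mem_split hg'
        exact ⟨by simp [hsupp, hq], hcost.trans hg⟩
      rw [Gate.length_split] at this
      exact m.le_succ.trans this
  exact ⟨_, by simp only [toOp_append, toOp_split hg, toOp], hm⟩

theorem Executable.exists_phaseDepth_eq {C : Circuit n} {d D : ℕ} (h : C.Executable d)
    (hd : d ≤ D) (hD : 2 ≤ D) (q : Fin n) :
    ∃ C' : Circuit n, C'.toOp = C.toOp ∧ C'.phaseDepth = D := by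
  by_cases hC : ∃ g ∈ C, g.phaseCost = 1
  · obtain ⟨g, hgC, hg⟩ := hC
    exact h.exists_phaseDepth_eq_of_mem hd hgC hg
  · have hzero : C.Executable 0 := executable_zero fun g hg => by
      have := g.phaseCost_le_one
      have : g.phaseCost ≠ 1 := fun h => hC ⟨g, hg, h⟩
      omega
    have htwo : Executable ([Gate.Z 1 le_rfl q] ++ [Gate.Zdag 1 le_rfl q]) (1 + 1) :=
      (executable_one (List.pairwise_singleton _ _)).append
        (executable_one (List.pairwise_singleton _ _))
    obtain ⟨C', hop, hdepth⟩ := (hzero.append htwo).exists_phaseDepth_eq_of_mem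
      (g := Gate.Z 1 le_rfl q) (by omega) (by simp) rfl
    refine ⟨C', ?_, hdepth⟩
    rw [hop, toOp_append, toOp_append, toOp_singleton, toOp_singleton, Gate.toOp_Z,
      Gate.toOp_Zdag, neg_smul, ← phase_add, neg_add_cancel, phase_zero, one_mul]

end Circuit

/-! ### Circuit identities -/

/-- The basis vector `|y⟩`. -/
def ket (y : Basis n) : Basis n → ℂ := Pi.single y 1

theorem op_ext {A B : Op n} (h : ∀ y, A.mulVec (ket y) = B.mulVec (ket y)) : A = B :=
  Matrix.ext_of_mulVec_single h

theorem phase_mulVec_ket (g : Basis n → ℝ) (y : Basis n) :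
    (phase g).mulVec (ket y) = Complex.exp (Complex.I * Real.pi * (g y : ℂ)) • ket y := by
  rw [phase, ket, Matrix.diagonal_mulVec_single, ← Pi.single_smul', smul_eq_mul]

theorem ofBasisMap_mulVec_ket (f : Basis n → Basis n) (y : Basis n) :
    (ofBasisMap f).mulVec (ket y) = ket (f y) := by
  ext x
  simp [ofBasisMap, ket, Pi.single_apply]

theorem onQubit_mulVec_ket (U : Matrix (Fin 2) (Fin 2) ℂ) (q : Fin n) (y : Basis n) :
    (onQubit U q).mulVec (ket y) = ∑ b, U b (y q) • ket (Function.update y q b) := by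
  ext x
  by_cases h : ∀ j, j ≠ q → x j = y j
  · have hx (b : Fin 2) : x = Function.update y q b ↔ x q = b := by
      rw [Function.eq_update_iff]
      exact and_iff_left h
    simp [ket, onQubit, Pi.single_apply, hx, if_pos h]
  · have hx (b : Fin 2) : x ≠ Function.update y q b := fun hb =>
      h (Function.eq_update_iff.1 hb).2
    simp [ket, onQubit, hx, if_neg h]

theorem ofBasisMap_comp (f g : Basis n → Basis n) :
    ofBasisMap (f ∘ g) = ofBasisMap f * ofBasisMap g := by
  refine op_ext fun y => ?_
  simp only [← Matrix.mulVec_mulVec, ofBasisMap_mulVec_ket, Function.comp_apply]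

theorem ofBasisMap_id : ofBasisMap (id : Basis n → Basis n) = 1 := by
  refine op_ext fun y => ?_
  rw [ofBasisMap_mulVec_ket, Matrix.one_mulVec, id]

theorem phase_mul_ofBasisMap (g : Basis n → ℝ) (f : Basis n → Basis n) :
    phase g * ofBasisMap f = ofBasisMap f * phase (g ∘ f) := by
  refine op_ext fun y => ?_
  simp only [← Matrix.mulVec_mulVec, ofBasisMap_mulVec_ket, Matrix.mulVec_smul, phase_mulVec_ket,
    Function.comp_apply]

/-- The Hadamard gate on qubit `q`. -/
def had (q : Fin n) : Op n := onQubit hadamard q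

theorem had_mulVec_ket (q : Fin n) (y : Basis n) :
    (had q).mulVec (ket y) = ∑ b, hadamard b (y q) • ket (Function.update y q b) :=
  onQubit_mulVec_ket hadamard q y

theorem sum_hadamard_mul_hadamard (u v : Fin 2) :
    ∑ b, hadamard u b * hadamard b v = if u = v then 1 else 0 := by
  have h : ((Real.sqrt 2 : ℝ) : ℂ)⁻¹ * ((Real.sqrt 2 : ℝ) : ℂ)⁻¹ = 1 / 2 := by
    rw [← mul_inv, ← Complex.ofReal_mul, Real.mul_self_sqrt (by norm_num)]
    norm_num
  fin_cases u <;> fin_cases v <;> simp [hadamard, h] <;> norm_num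

theorem had_mul_had (q : Fin n) : had q * had q = 1 := by
  refine op_ext fun y => ?_
  simp only [← Matrix.mulVec_mulVec, had_mulVec_ket, Matrix.mulVec_sum, Matrix.one_mulVec,
    Matrix.mulVec_smul, Function.update_self, Function.update_idem, Finset.smul_sum, smul_smul]
  rw [Finset.sum_comm]
  simp only [← Finset.sum_smul, mul_comm (hadamard _ (y q)), sum_hadamard_mul_hadamard]
  simp

theorem had_inv (q : Fin n) : (had q)⁻¹ = had q :=
  Matrix.inv_eq_left_inv (had_mul_had q)

theorem isUnit_had (q : Fin n) : IsUnit (had q) :=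
  .of_mul_eq_one _ (had_mul_had q)

theorem commute_phase_had {g : Basis n → ℝ} {q : Fin n} (hg : DependsOn g {q}ᶜ) :
    Commute (phase g) (had q) := by
  refine op_ext fun y => ?_
  have hupdate (b : Fin 2) : g (Function.update y q b) = g y :=
    hg fun i hi => Function.update_of_ne hi _ _
  simp only [← Matrix.mulVec_mulVec, had_mulVec_ket, Matrix.mulVec_sum, Matrix.mulVec_smul,
    phase_mulVec_ket, hupdate, Finset.smul_sum, smul_smul, mul_comm]

theorem commute_ofBasisMap_had {f : Basis n → Basis n} {q : Fin n}
    (hf : ∀ y b, f (Function.update y q b) = Function.update (f y) q b) :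
    Commute (ofBasisMap f) (had q) := by
  refine op_ext fun y => ?_
  have hq : f y q = y q := by
    rw [← Function.update_eq_self q y, hf, Function.update_self, Function.update_eq_self]
  simp only [← Matrix.mulVec_mulVec, had_mulVec_ket, Matrix.mulVec_sum, Matrix.mulVec_smul,
    ofBasisMap_mulVec_ket, hf, hq]

/-- The basis map that adds `p y` to the bit of qubit `t`. -/
def toggle (t : Fin n) (p : Basis n → Fin 2) (y : Basis n) : Basis n :=
  Function.update y t (y t + p y)

theorem toggle_self (t : Fin n) (p : Basis n → Fin 2) (y : Basis n) :
    toggle t p y t = y t + p y :=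
  Function.update_self _ _ _

theorem toggle_of_ne {t i : Fin n} (h : i ≠ t) (p : Basis n → Fin 2) (y : Basis n) :
    toggle t p y i = y i :=
  Function.update_of_ne h _ _

theorem hadamard_apply_add (b u v : Fin 2) : hadamard b (u + v) =
    Complex.exp (Complex.I * Real.pi * (((b * v).val : ℝ) : ℂ)) * hadamard b u := by
  fin_cases b <;> fin_cases u <;> fin_cases v <;>
    simp [hadamard, mul_comm Complex.I, Complex.exp_pi_mul_I]

theorem semiconjBy_had_toggle {t : Fin n} {p : Basis n → Fin 2} (hp : DependsOn p {t}ᶜ) :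
    SemiconjBy (had t) (ofBasisMap (toggle t p)) (phase fun y => ((y t * p y).val : ℝ)) := by
  refine op_ext fun y => ?_
  have hupdate (b : Fin 2) : p (Function.update y t b) = p y :=
    hp fun i hi => Function.update_of_ne hi _ _
  simp only [← Matrix.mulVec_mulVec, ofBasisMap_mulVec_ket, had_mulVec_ket, toggle_self,
    hadamard_apply_add, Matrix.mulVec_sum, Matrix.mulVec_smul, phase_mulVec_ket, hupdate,
    Function.update_self, smul_smul, mul_comm]
  simp only [toggle, Function.update_idem]

theorem mct_eq_had_mul_phase_mul_had (t : Fin n) :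
    mct t = had t * phase (fun y => ((∏ j, y j).val : ℝ)) * had t := by
  have hp : DependsOn (fun y : Basis n => ∏ j ∈ Finset.univ.erase t, y j) {t}ᶜ :=
    fun x y h => Finset.prod_congr rfl fun j hj => h j (Finset.ne_of_mem_erase hj)
  have h := (semiconjBy_had_toggle hp).eq
  simp only [Finset.mul_prod_erase _ _ (Finset.mem_univ t)] at h
  rw [mul_assoc, ← h, ← mul_assoc, had_mul_had, one_mul]
  rfl

/-- The operator has a circuit that can be executed in `d` phase cycles. -/
def Realizable (d : ℕ) (U : Op n) : Prop :=
  ∃ C : Circuit n, C.toOp = U ∧ C.Executable d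

theorem Realizable.mul {d e : ℕ} {U V : Op n} (hU : Realizable d U) (hV : Realizable e V) :
    Realizable (d + e) (U * V) := by
  obtain ⟨C, rfl, hC⟩ := hU
  obtain ⟨D, rfl, hD⟩ := hV
  exact ⟨D ++ C, Circuit.toOp_append D C, add_comm e d ▸ hD.append hC⟩

theorem Realizable.mono {d e : ℕ} {U : Op n} (hU : Realizable d U) (h : d ≤ e) :
    Realizable e U := by
  obtain ⟨C, hop, hC⟩ := hU
  exact ⟨C, hop, hC.mono h⟩

theorem realizable_one : Realizable 0 (1 : Op n) :=
  ⟨[], rfl, Circuit.executable_zero (by simp)⟩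

theorem realizable_had (q : Fin n) : Realizable 0 (had q) :=
  ⟨[Gate.H q], Circuit.toOp_singleton _, Circuit.executable_zero (by simp [Gate.phaseCost])⟩

theorem realizable_mct_of_phase {d : ℕ} {t : Fin n}
    (h : Realizable d (phase fun y : Basis n => ((∏ j, y j).val : ℝ))) : Realizable d (mct t) := by
  rw [mct_eq_had_mul_phase_mul_had, ← zero_add d]
  exact ((realizable_had t).mul h).mul (realizable_had t)

theorem realizable_phase_sum {d : ℕ} {g : ℕ → Basis n → ℝ}
    (h : ∀ i < d, Realizable 1 (phase (g i))) :
    Realizable d (phase (∑ i ∈ Finset.range d, g i)) := by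
  induction d with
  | zero => simpa only [Finset.range_zero, Finset.sum_empty, phase_zero] using realizable_one
  | succ d ih =>
    rw [Finset.sum_range_succ, phase_add]
    exact (ih fun i hi => h i (hi.trans d.lt_succ_self)).mul (h d d.lt_succ_self)

/-- The basis map of a CNOT gate with control `c` and target `t`. -/
def cnot (c t : Fin n) : Basis n → Basis n := toggle t fun y => y c

theorem realizable_cnot {c t : Fin n} (h : c ≠ t) : Realizable 0 (ofBasisMap (cnot c t)) :=
  ⟨[Gate.CNOT c t h], Circuit.toOp_singleton _,
    Circuit.executable_zero (by simp [Gate.phaseCost])⟩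

theorem cnot_cnot {c t : Fin n} (h : c ≠ t) (y : Basis n) : cnot c t (cnot c t y) = y := by
  have hadd (u v : Fin 2) : u + v + v = u := by revert u v; decide
  simp [cnot, toggle, h, hadd]

/-- The basis maps computed by CNOT gates. -/
inductive IsCNOTMap : (Basis n → Basis n) → Prop
  | id : IsCNOTMap id
  | cnot_comp {f : Basis n → Basis n} {c t : Fin n} (hct : c ≠ t) (hf : IsCNOTMap f) :
    IsCNOTMap (cnot c t ∘ f)

namespace IsCNOTMap

variable {f g : Basis n → Basis n}

theorem comp (hf : IsCNOTMap f) (hg : IsCNOTMap g) : IsCNOTMap (f ∘ g) := by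
  induction hf with
  | id => exact hg
  | cnot_comp hct _ ih => exact cnot_comp hct ih

theorem cnot {c t : Fin n} (hct : c ≠ t) : IsCNOTMap (cnot c t) :=
  cnot_comp hct id

theorem iterate (hf : IsCNOTMap f) (i : ℕ) :
    IsCNOTMap f^[i] := by
  induction i with
  | zero => exact .id
  | succ i ih => exact ih.comp hf

theorem exists_leftInverse (hf : IsCNOTMap f) : ∃ g, IsCNOTMap g ∧ g ∘ f = _root_.id := by
  induction hf with
  | id => exact ⟨_, id, rfl⟩
  | @cnot_comp f c t hct _ ih =>
    obtain ⟨g, hg, hgf⟩ := ih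
    refine ⟨g ∘ CliffordZN.cnot c t, hg.comp (cnot hct), funext fun y => ?_⟩
    simpa only [Function.comp_apply, cnot_cnot hct] using congrFun hgf y

theorem realizable (hf : IsCNOTMap f) : Realizable 0 (ofBasisMap f) := by
  induction hf with
  | id => rw [ofBasisMap_id]; exact realizable_one
  | cnot_comp hct _ ih => rw [ofBasisMap_comp]; exact (realizable_cnot hct).mul ih

theorem realizable_phase_comp {d : ℕ} {p : Basis n → ℝ} (hf : IsCNOTMap f)
    (hp : Realizable d (phase p)) : Realizable d (phase (p ∘ f)) := by
  obtain ⟨g, hg, hgf⟩ := hf.exists_leftInverse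
  have h : ofBasisMap g * phase p * ofBasisMap f = phase (p ∘ f) := by
    rw [mul_assoc, phase_mul_ofBasisMap, ← mul_assoc, ← ofBasisMap_comp, hgf, ofBasisMap_id,
      one_mul]
  rw [← h, ← zero_add d]
  exact (hg.realizable.mul hp).mul hf.realizable

end IsCNOTMap

/-- The basis map that adds bit `c` to every bit in `A`. -/
def fan (c : Fin n) (A : Finset (Fin n)) (y : Basis n) : Basis n :=
  fun i => if i ∈ A then y i + y c else y i

theorem isCNOTMap_fan {c : Fin n} {A : Finset (Fin n)} (hc : c ∉ A) : IsCNOTMap (fan c A) := by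
  induction A using Finset.induction_on with
  | empty =>
    convert IsCNOTMap.id using 1
    funext y i
    simp [fan]
  | insert a A ha ih =>
    rw [Finset.mem_insert, not_or] at hc
    convert (ih hc.2).cnot_comp hc.1 using 1
    funext y i
    by_cases hi : i = a
    · subst hi
      simp [fan, cnot, toggle_self, ha, hc.2]
    · simp [fan, cnot, toggle_of_ne hi, hi]

/-- The multiples of `π` by which a phase gate, or no gate, shifts the phase. -/
def IsPhaseAngle (a : ℝ) : Prop :=
  a = 0 ∨ ∃ k : ℕ, 1 ≤ k ∧ |a| = (2 ^ k : ℝ)⁻¹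

namespace IsPhaseAngle

theorem zero : IsPhaseAngle 0 := Or.inl rfl

theorem neg {a : ℝ} (h : IsPhaseAngle a) : IsPhaseAngle (-a) := by
  rwa [IsPhaseAngle, neg_eq_zero, abs_neg]

theorem mul_of_abs_eq_one {a c : ℝ} (h : IsPhaseAngle a) (hc : |c| = 1) :
    IsPhaseAngle (c * a) := by
  rcases eq_or_eq_neg_of_abs_eq hc with rfl | rfl
  · rwa [one_mul]
  · rw [neg_one_mul]
    exact h.neg

theorem two_pow_div {l j : ℕ} (h : l < j) : IsPhaseAngle (2 ^ l / 2 ^ j) := by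
  refine Or.inr ⟨j - l, Nat.sub_pos_of_lt h, ?_⟩
  rw [abs_of_pos (by positivity), ← inv_div, pow_sub₀ _ two_ne_zero h.le, div_eq_mul_inv]

theorem exists_circuit {a : ℝ} (ha : IsPhaseAngle a) (q : Fin n) :
    ∃ C : Circuit n, C.toOp = phase (a • bit q) ∧
      (C.Pairwise fun g g' => Disjoint g.support g'.support) ∧ ∀ g ∈ C, g.support = {q} := by
  rcases ha with rfl | ⟨k, hk, ha⟩
  · exact ⟨[], by rw [zero_smul, phase_zero, Circuit.toOp], by simp, by simp⟩
  · rcases eq_or_eq_neg_of_abs_eq ha with rfl | rfl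
    · exact ⟨[Gate.Z k hk q], by rw [Circuit.toOp_singleton, Gate.toOp_Z], by simp,
        by simp [Gate.support]⟩
    · exact ⟨[Gate.Zdag k hk q], by rw [Circuit.toOp_singleton, Gate.toOp_Zdag], by simp,
        by simp [Gate.support]⟩

end IsPhaseAngle

theorem toOp_flatMap {L : List (Fin n)} {C : Fin n → Circuit n} {g : Fin n → Basis n → ℝ}
    (h : ∀ q ∈ L, (C q).toOp = phase (g q)) :
    Circuit.toOp (L.flatMap C) = phase (L.map g).sum := by
  induction L with
  | nil => exact phase_zero.symm
  | cons q L ih =>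
    rw [List.forall_mem_cons] at h
    rw [List.flatMap_cons, Circuit.toOp_append, ih h.2, h.1, List.map_cons, List.sum_cons,
      add_comm, phase_add]

theorem realizable_phase_sum_bit {a : Fin n → ℝ} {s : Finset (Fin n)}
    (ha : ∀ q ∈ s, IsPhaseAngle (a q)) : Realizable 1 (phase (∑ q ∈ s, a q • bit q)) := by
  choose! C hop hpairwise hsupp using fun q hq => (ha q hq).exists_circuit q
  simp only [← Finset.mem_toList (s := s)] at hop hpairwise hsupp
  refine ⟨s.toList.flatMap C, ?_, Circuit.executable_one ?_⟩
  · rw [toOp_flatMap hop, Finset.sum_map_toList]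
  · refine List.pairwise_flatMap.2 ⟨hpairwise, ?_⟩
    refine s.nodup_toList.imp_of_mem fun {p q} hp hq hpq g hg g' hg' => ?_
    rw [hsupp p hp g hg, hsupp q hq g' hg', Finset.disjoint_singleton]
    exact hpq

theorem realizable_phase_add_sum_bit {a : Fin n → ℝ} {b : ℝ} {c : Fin n} {s : Finset (Fin n)}
    (ha : ∀ q ∈ s, IsPhaseAngle (a q)) (hb : IsPhaseAngle b) (hc : c ∉ s) :
    Realizable 1 (phase (b • bit c + ∑ q ∈ s, a q • bit q)) := by
  have hne : ∀ q ∈ s, Function.update a c b q = a q := fun q hq =>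
    Function.update_of_ne (ne_of_mem_of_not_mem hq hc) _ _
  have h : b • bit c + ∑ q ∈ s, a q • bit q =
      ∑ q ∈ insert c s, Function.update a c b q • bit q := by
    rw [Finset.sum_insert hc, Function.update_self]
    exact congrArg _ (Finset.sum_congr rfl fun q hq => by rw [hne q hq])
  rw [h]
  refine realizable_phase_sum_bit (Finset.forall_mem_insert _ _ _ |>.2 ⟨?_, fun q hq => ?_⟩)
  · rwa [Function.update_self]
  · rw [hne q hq]
    exact ha q hq

theorem realizable_phase_add_sum_xorBit {a : Fin n → ℝ} {b : ℝ} {c p : Fin n}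
    {s : Finset (Fin n)} (ha : ∀ q ∈ s, IsPhaseAngle (a q)) (hb : IsPhaseAngle b) (hc : c ∉ s)
    (hp : p ∈ s) : Realizable 1 (phase (b • bit p + ∑ q ∈ s, a q • xorBit q c)) := by
  -- Once its parities with the qubits in `s` are formed, the qubit `c` can hold the bit of `p`.
  let f := cnot p c ∘ fan c s
  have hfree : bit p = bit c ∘ f := by
    have hadd (u v : Fin 2) : u + (v + u) = v := by revert u v; decide
    funext y
    simp only [f, Function.comp_apply, bit, cnot, toggle_self, fan, if_pos hp, if_neg hc, hadd]
  have hparity : ∀ q ∈ s, a q • xorBit q c = (a q • bit q) ∘ f := by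
    intro q hq
    funext y
    simp only [f, Function.comp_apply, Pi.smul_apply, bit, xorBit, cnot,
      toggle_of_ne (ne_of_mem_of_not_mem hq hc), fan, if_pos hq]
  have h : b • bit p + ∑ q ∈ s, a q • xorBit q c = (b • bit c + ∑ q ∈ s, a q • bit q) ∘ f := by
    rw [Finset.sum_congr rfl hparity, hfree]
    funext y
    simp only [Pi.add_apply, Function.comp_apply, Finset.sum_apply, Pi.smul_apply]
  rw [h]
  exact ((isCNOTMap_fan hc).cnot_comp (ne_of_mem_of_not_mem hp hc)).realizable_phase_comp
    (realizable_phase_add_sum_bit ha hb hc)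

theorem realizable_phase_sum_bit_sub_xorBit {a : Fin n → ℝ} {b : ℝ} {c : Fin n}
    {s : Finset (Fin n)} (ha : ∀ q ∈ s, IsPhaseAngle (a q)) (hb : IsPhaseAngle b) (hc : c ∉ s)
    (hs : s.Nonempty) :
    Realizable 2 (phase (∑ q ∈ s, a q • (bit q - xorBit q c) + b • bit c)) := by
  obtain ⟨p, hp⟩ := hs
  have hparities := realizable_phase_add_sum_xorBit (fun q hq => (ha q hq).neg) .zero hc hp
  convert (realizable_phase_add_sum_bit ha hb hc).mul hparities using 1
  simp only [← phase_add, smul_sub, Finset.sum_sub_distrib, neg_smul, Finset.sum_neg_distrib,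
    zero_smul]
  congr 1
  abel

/-! ### Four and five qubits -/

theorem isCNOTMap_foldl {α : Type*} {c t : α → Fin n} (h : ∀ a, c a ≠ t a) (L : List α) :
    IsCNOTMap fun y => L.foldl (fun z a => cnot (c a) (t a) z) y := by
  induction L with
  | nil => exact .id
  | cons a L ih => exact ih.comp (.cnot (h a))

section LFSR

variable {k t : Fin n} {d : ℕ}

/-- The linear feedback shift register `s (j + n) = s j + s (j + k)`, advanced by `n` steps: if
the qubits hold `s 0, …, s (n - 1)`, then they hold `s n, …, s (2 n - 1)` afterwards. The sum
`q + k` is taken modulo `n`, which refers to a bit that has already been updated when it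
wraps around. -/
def lfsr (k : Fin n) (y : Basis n) : Basis n :=
  (List.finRange n).foldl (fun z q => cnot (q + k) q z) y

theorem isCNOTMap_lfsr [NeZero n] (hk : k ≠ 0) : IsCNOTMap (lfsr k) :=
  isCNOTMap_foldl (fun q => by simpa using hk) _

/-- The coefficient of the `(n i + q)`-th parity of a maximal-period register in the expansion of
`2 ^ (n - 1) ∏ y`. The sign is `-(-1) ^ w` with `w` the number of terms of the parity, and `w` mod
`2` is the value of the parity at the all-ones state. The register repeats itself after
`2 ^ n - 1` parities. -/
def lfsrCoeff (k : Fin n) (i : ℕ) (q : Fin n) : ℤ :=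
  if n * i + q < 2 ^ n - 1 then 2 * ((lfsr k)^[i] 1 q).val - 1 else 0

theorem isPhaseAngle_lfsrCoeff (hn : 2 ≤ n) (i : ℕ) (q : Fin n) :
    IsPhaseAngle ((lfsrCoeff k i q : ℝ) / 2 ^ (n - 1)) := by
  have hpos : IsPhaseAngle (1 / 2 ^ (n - 1)) := by
    simpa using IsPhaseAngle.two_pow_div (l := 0) (j := n - 1) (by omega)
  rw [lfsrCoeff]
  split_ifs
  · generalize (lfsr k)^[i] 1 q = u
    fin_cases u
    · simpa [neg_div] using hpos.neg
    · convert hpos using 2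
      norm_num
  · simpa using IsPhaseAngle.zero

theorem realizable_mct_of_lfsr [NeZero n] (hn : 2 ≤ n) (hk : k ≠ 0)
    (h : ∀ y : Basis n, ∑ i ∈ Finset.range d, ∑ q, lfsrCoeff k i q * ((lfsr k)^[i] y q).val =
      2 ^ (n - 1) * (∏ j, y j).val) : Realizable d (mct t) := by
  let g (i : ℕ) : Basis n → ℝ :=
    (∑ q, ((lfsrCoeff k i q : ℝ) / 2 ^ (n - 1)) • bit q) ∘ (lfsr k)^[i]
  have hg : (fun y : Basis n => ((∏ j, y j).val : ℝ)) = ∑ i ∈ Finset.range d, g i := by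
    funext y
    have hy := congrArg (Int.cast (R := ℝ)) (h y)
    push_cast at hy
    simp only [g, Finset.sum_apply, Function.comp_apply, Pi.smul_apply, smul_eq_mul, bit,
      div_mul_eq_mul_div, ← Finset.sum_div, hy]
    rw [mul_div_cancel_left₀ _ (by positivity)]
  refine realizable_mct_of_phase ?_
  rw [hg]
  exact realizable_phase_sum fun i _ => ((isCNOTMap_lfsr hk).iterate i).realizable_phase_comp
    (realizable_phase_sum_bit fun q _ => isPhaseAngle_lfsrCoeff hn i q)

end LFSR

theorem realizable_mct_four (t : Fin 4) : Realizable 4 (mct t) :=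
  -- The polynomial `x ^ 4 + x + 1` is primitive over the field with two elements.
  realizable_mct_of_lfsr (k := 1) (by decide) (by decide) (by decide +kernel)

theorem realizable_mct_five (t : Fin 5) : Realizable 7 (mct t) :=
  -- The polynomial `x ^ 5 + x ^ 2 + 1` is primitive over the field with two elements.
  realizable_mct_of_lfsr (k := 2) (by decide) (by decide) (by decide +kernel)

/-! ### Controlled increments -/

section Increment

variable {m : ℕ}

/-- The controlled increment: if bit `0` is set, it increments the integer whose binary digits,
least significant first, are the bits `1, …, j`, modulo `2 ^ j`. -/
def inc (j : Fin (m + 1)) (y : Basis (m + 1)) : Basis (m + 1) :=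
  fun i => if 0 < i ∧ i ≤ j then y i + ∏ l ∈ Finset.Iio i, y l else y i

theorem inc_zero : inc (0 : Fin (m + 1)) = id := by
  funext y i
  exact if_neg fun h => h.1.not_ge h.2

theorem inc_of_lt {i j : Fin (m + 1)} (h : j < i) (y : Basis (m + 1)) : inc j y i = y i :=
  if_neg fun hi => hi.2.not_gt h

theorem inc_apply_zero (j : Fin (m + 1)) (y : Basis (m + 1)) : inc j y 0 = y 0 :=
  if_neg fun h => h.1.false

theorem inc_update {i j : Fin (m + 1)} (h : j < i) (y : Basis (m + 1)) (b : Fin 2) :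
    inc j (Function.update y i b) = Function.update (inc j y) i b := by
  funext l
  rcases eq_or_ne l i with rfl | hl
  · rw [inc_of_lt h, Function.update_self, Function.update_self]
  · rw [Function.update_of_ne hl, inc, inc, Function.update_of_ne hl]
    refine ite_congr rfl (fun hlj => ?_) fun _ => rfl
    congr 1
    refine Finset.prod_congr rfl fun k hk => Function.update_of_ne ?_ _ _
    exact ((Finset.mem_Iio.1 hk).trans_le hlj.2 |>.trans h).ne

theorem inc_succ (i : Fin m) :
    inc i.succ = inc i.castSucc ∘ toggle i.succ fun y => ∏ l ∈ Finset.Iic i.castSucc, y l := by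
  funext y l
  have hIio : Finset.Iio i.succ = Finset.Iic i.castSucc := by
    ext l
    simp [Fin.lt_def, Fin.le_def]
  rw [Function.comp_apply, toggle, inc_update i.castSucc_lt_succ]
  rcases eq_or_ne l i.succ with rfl | hl
  · rw [Function.update_self, inc, if_pos ⟨i.succ_pos, le_rfl⟩, hIio]
  · rw [Function.update_of_ne hl, inc, inc]
    have : l ≤ i.succ ↔ l ≤ i.castSucc := by
      rw [Fin.le_castSucc_iff, hl.le_iff_lt]
    simp only [this]

theorem Ioc_zero_succ (i : Fin m) :
    Finset.Ioc 0 i.succ = insert i.succ (Finset.Ioc 0 i.castSucc) := by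
  ext l
  simp only [Finset.mem_Ioc, Finset.mem_insert, Fin.lt_def, Fin.le_def, Fin.ext_iff, Fin.val_succ,
    Fin.val_castSucc, Fin.val_zero]
  omega

theorem sum_Ioc_zero_succ {M : Type*} [AddCommMonoid M] (f : Fin (m + 1) → M) (i : Fin m) :
    ∑ l ∈ Finset.Ioc 0 i.succ, f l = ∑ l ∈ Finset.Ioc 0 i.castSucc, f l + f i.succ := by
  rw [Ioc_zero_succ, Finset.sum_insert (by simp), add_comm]

/-- Twice the integer whose binary digits, least significant first, are the bits `1, …, j`. -/
def value (j : Fin (m + 1)) : Basis (m + 1) → ℝ :=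
  ∑ l ∈ Finset.Ioc 0 j, (2 ^ l.val : ℝ) • bit l

theorem value_zero : value (0 : Fin (m + 1)) = 0 := by
  simp [value]

theorem value_succ (i : Fin m) :
    value i.succ = value i.castSucc + (2 ^ (i.val + 1) : ℝ) • bit i.succ := by
  rw [value, sum_Ioc_zero_succ, Fin.val_succ, value]

theorem value_congr {j : Fin (m + 1)} {x y : Basis (m + 1)}
    (h : ∀ i ∈ Finset.Ioc 0 j, x i = y i) : value j x = value j y := by
  simp only [value, Finset.sum_apply, Pi.smul_apply, bit]
  exact Finset.sum_congr rfl fun l hl => by rw [h l hl]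

theorem value_inc (j : Fin (m + 1)) (y : Basis (m + 1)) :
    value j (inc j y) =
      value j y + 2 * (y 0).val - 2 ^ (j.val + 1) * ((∏ l ∈ Finset.Iic j, y l).val : ℝ) := by
  induction j using Fin.induction with
  | zero =>
    have h : Finset.Iic (0 : Fin (m + 1)) = {0} := by ext l; simp
    simp [value_zero, h]
  | succ i ih =>
    have hIic : Finset.Iic i.succ = insert i.succ (Finset.Iic i.castSucc) := by
      ext l
      simp only [Finset.mem_Iic, Finset.mem_insert, Fin.le_def, Fin.ext_iff, Fin.val_succ,
        Fin.val_castSucc]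
      omega
    have hlow : value i.castSucc (inc i.succ y) = value i.castSucc (inc i.castSucc y) := by
      refine value_congr fun l hl => ?_
      rw [inc_succ, Function.comp_apply, toggle, inc_update i.castSucc_lt_succ]
      exact Function.update_of_ne ((Finset.mem_Ioc.1 hl).2.trans_lt i.castSucc_lt_succ).ne _ _
    have hsucc : inc i.succ y i.succ = y i.succ + ∏ l ∈ Finset.Iic i.castSucc, y l := by
      rw [inc_succ, Function.comp_apply, inc_of_lt i.castSucc_lt_succ, toggle_self]
    rw [value_succ, Pi.add_apply, Pi.add_apply, hlow, ih, hIic, Finset.prod_insert (by simp),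
      val_mul_eq]
    simp only [Pi.smul_apply, smul_eq_mul, bit, hsucc, val_add_eq, Fin.val_succ, Fin.val_castSucc]
    ring

end Increment

/-! ### The quantum Fourier transform of an increment -/

section Ladder

variable {m : ℕ} {φ ψ κ ρ : Fin m → Basis (m + 1) → ℝ} {g : Basis (m + 1) → ℝ} {j : Fin (m + 1)}

/-- The operator `Φ₀ H₁ Φ₁ H₂ ⋯` of `j` stages, where `Φ i` is the diagonal operator with phase
`φ i` and `H i` is the Hadamard gate on qubit `i`. The quantum Fourier transform on the qubits
`1, …, m` has this form. -/
def ladder (φ : Fin m → Basis (m + 1) → ℝ) : Fin (m + 1) → Op (m + 1) :=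
  Fin.partialProd fun i => phase (φ i) * had i.succ

theorem ladder_zero : ladder φ 0 = 1 :=
  Fin.partialProd_zero _

theorem ladder_succ (i : Fin m) :
    ladder φ i.succ = ladder φ i.castSucc * (phase (φ i) * had i.succ) :=
  Fin.partialProd_succ _ i

theorem isUnit_ladder (j : Fin (m + 1)) : IsUnit (ladder φ j) := by
  induction j using Fin.induction with
  | zero => rw [ladder_zero]; exact isUnit_one
  | succ i ih => rw [ladder_succ]; exact ih.mul ((isUnit_phase _).mul (isUnit_had _))

theorem commute_phase_ladder (hg : DependsOn g (Set.Ioc 0 j)ᶜ) :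
    Commute (phase g) (ladder φ j) := by
  induction j using Fin.induction with
  | zero => rw [ladder_zero]; exact Commute.one_right _
  | succ i ih =>
    have hsub : Set.Ioc 0 i.castSucc ⊆ Set.Ioc 0 i.succ :=
      Set.Ioc_subset_Ioc_right i.castSucc_lt_succ.le
    have hmem : i.succ ∈ Set.Ioc 0 i.succ := ⟨i.succ_pos, le_rfl⟩
    rw [ladder_succ]
    refine (ih (hg.mono (Set.compl_subset_compl.2 hsub))).mul_right
      ((commute_phase_phase _ _).mul_right (commute_phase_had (hg.mono ?_)))
    exact Set.compl_subset_compl.2 (Set.singleton_subset_iff.2 hmem)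

theorem dependsOn_partialSum (hρ : ∀ i, DependsOn (ρ i) (Set.Iio i.succ)) (j : Fin (m + 1)) :
    DependsOn (Fin.partialSum ρ j) (Set.Iio j) := by
  induction j using Fin.induction with
  | zero => rw [Fin.partialSum_zero]; exact fun _ _ _ => rfl
  | succ i ih =>
    intro x y h
    rw [Fin.partialSum_succ, Pi.add_apply, Pi.add_apply, hρ i h,
      ih fun l hl => h l (hl.trans i.castSucc_lt_succ)]

theorem ladder_add (hκ : ∀ i : Fin m, DependsOn (κ i) (Set.Ioc 0 i.castSucc)ᶜ)
    (hρ : ∀ i, DependsOn (ρ i) (Set.Iio i.succ)) (j : Fin (m + 1)) :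
    ladder (κ + ψ + ρ) j =
      phase (Fin.partialSum κ j) * ladder ψ j * phase (Fin.partialSum ρ j) := by
  induction j using Fin.induction with
  | zero => simp only [ladder_zero, Fin.partialSum_zero, phase_zero, mul_one]
  | succ i ih =>
    have hhad : Commute (phase (Fin.partialSum ρ i.succ)) (had i.succ) :=
      commute_phase_had ((dependsOn_partialSum hρ i.succ).mono fun l hl => hl.ne)
    have hladder := (commute_phase_ladder (φ := ψ) (hκ i)).eq
    calc ladder (κ + ψ + ρ) i.succ
        = phase (Fin.partialSum κ i.castSucc) * ladder ψ i.castSucc *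
            (phase (Fin.partialSum ρ i.castSucc + (κ i + ψ i + ρ i)) * had i.succ) := by
          simp only [ladder_succ, ih, phase_add, mul_assoc, Pi.add_apply]
      _ = phase (Fin.partialSum κ i.castSucc) * (ladder ψ i.castSucc * phase (κ i)) *
            (phase (ψ i) * (phase (Fin.partialSum ρ i.succ) * had i.succ)) := by
          rw [show Fin.partialSum ρ i.castSucc + (κ i + ψ i + ρ i) =
            κ i + (ψ i + Fin.partialSum ρ i.succ) by rw [Fin.partialSum_succ]; abel]
          simp only [phase_add, mul_assoc]
      _ = phase (Fin.partialSum κ i.succ) * ladder ψ i.succ * phase (Fin.partialSum ρ i.succ) := by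
          rw [← hladder, hhad.eq]
          simp only [ladder_succ, Fin.partialSum_succ κ, phase_add, mul_assoc]

end Ladder

section Fourier

variable {m : ℕ}

/-- The controlled phases of the quantum Fourier transform on qubit `i + 1`. -/
def fourierPhase (i : Fin m) : Basis (m + 1) → ℝ :=
  (1 / 2 ^ (i.val + 1) : ℝ) • (bit i.succ * value i.castSucc)

/-- The phase by which the Fourier transform turns an increment controlled by qubit `0` into
phases on the digit `i + 1`. -/
def shiftPhase (i : Fin m) : Basis (m + 1) → ℝ :=
  (2 / 2 ^ (i.val + 1) : ℝ) • (bit 0 * bit i.succ)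

theorem fourierPhase_comp_inc_add (i : Fin m) :
    (fourierPhase i ∘ inc i.castSucc +
      fun y => ((y i.succ * ∏ l ∈ Finset.Iic i.castSucc, y l).val : ℝ)) =
      fourierPhase i + shiftPhase i := by
  funext y
  simp only [Pi.add_apply, Function.comp_apply, fourierPhase, shiftPhase, Pi.smul_apply,
    Pi.mul_apply, smul_eq_mul, bit, inc_of_lt i.castSucc_lt_succ, value_inc, val_mul_eq,
    Fin.val_castSucc]
  field_simp
  ring

theorem shiftPhase_comp_inc (i : Fin m) : shiftPhase i ∘ inc i.castSucc = shiftPhase i := by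
  funext y
  simp only [Function.comp_apply, shiftPhase, Pi.smul_apply, Pi.mul_apply, bit, inc_apply_zero,
    inc_of_lt i.castSucc_lt_succ]

theorem semiconjBy_phase_mul_had_inc (i : Fin m) :
    SemiconjBy (phase (fourierPhase i) * had i.succ) (ofBasisMap (inc i.succ))
      (phase (shiftPhase i) * ofBasisMap (inc i.castSucc)) := by
  have hcarry : DependsOn (fun y : Basis (m + 1) => ∏ l ∈ Finset.Iic i.castSucc, y l)
      {i.succ}ᶜ := fun x y h => Finset.prod_congr rfl fun l hl =>
    h l ((Finset.mem_Iic.1 hl).trans_lt i.castSucc_lt_succ).ne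
  have hinc : Commute (ofBasisMap (inc i.castSucc)) (had i.succ) :=
    commute_ofBasisMap_had (inc_update i.castSucc_lt_succ)
  calc phase (fourierPhase i) * had i.succ * ofBasisMap (inc i.succ)
      = phase (fourierPhase i) * ofBasisMap (inc i.castSucc) *
          phase (fun y => ((y i.succ * ∏ l ∈ Finset.Iic i.castSucc, y l).val : ℝ)) *
            had i.succ := by
        rw [inc_succ, ofBasisMap_comp, mul_assoc, ← mul_assoc (had _), ← hinc.eq,
          mul_assoc _ (had _), (semiconjBy_had_toggle hcarry).eq]
        simp only [mul_assoc]
    _ = ofBasisMap (inc i.castSucc) * (phase (shiftPhase i ∘ inc i.castSucc) *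
          phase (fourierPhase i)) * had i.succ := by
        rw [phase_mul_ofBasisMap, mul_assoc (ofBasisMap _), ← phase_add,
          fourierPhase_comp_inc_add, shiftPhase_comp_inc, ← phase_add, add_comm (fourierPhase i)]
    _ = phase (shiftPhase i) * ofBasisMap (inc i.castSucc) *
          (phase (fourierPhase i) * had i.succ) := by
        simp only [phase_mul_ofBasisMap, mul_assoc]

theorem semiconjBy_ladder_fourierPhase_inc (j : Fin (m + 1)) :
    SemiconjBy (ladder fourierPhase j) (ofBasisMap (inc j))
      (phase (Fin.partialSum shiftPhase j)) := by
  induction j using Fin.induction with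
  | zero =>
    rw [inc_zero, ofBasisMap_id, Fin.partialSum_zero, phase_zero]
    exact SemiconjBy.one_right _
  | succ i ih =>
    have hshift : DependsOn (shiftPhase i) (Set.Ioc 0 i.castSucc)ᶜ := fun x y h => by
      simp only [shiftPhase, Pi.smul_apply, Pi.mul_apply, bit, h 0 fun h0 => h0.1.false,
        h i.succ fun hi => hi.2.not_gt i.castSucc_lt_succ]
    rw [ladder_succ, Fin.partialSum_succ, add_comm (Fin.partialSum _ _), phase_add]
    exact SemiconjBy.mul_left (SemiconjBy.mul_right (commute_phase_ladder hshift).symm ih)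
      (semiconjBy_phase_mul_had_inc i)

end Fourier

/-! ### Fourier stages in one cycle -/

section Stage

variable {m : ℕ}

/-- The phase on qubit `i`, one digit behind the target `i + 1` of the stage, such that the slots
of the stages `0, …, i` add up to the value of the digits `1, …, i`. There is no digit behind the
first target. -/
def slotPhase (i : Fin m) : Basis (m + 1) → ℝ :=
  if i.val = 0 then 0 else (2 ^ i.val : ℝ) • bit i.castSucc

/-- The two-qubit part of `fourierPhase i`, rewritten in terms of parities, together with `w` times
the slot phase. It takes a single cycle, since `slotPhase i` uses the qubit `i + 1`, which is
left idle by the parities. -/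
def stagePhase (w : ℝ) (i : Fin m) : Basis (m + 1) → ℝ :=
  w • slotPhase i -
    ∑ l ∈ Finset.Ioc 0 i.castSucc, (2 ^ l.val / 2 ^ (i.val + 2) : ℝ) • xorBit l i.succ

/-- The part of `fourierPhase i` that acts on the target qubit alone. -/
def targetPhase (i : Fin m) : Basis (m + 1) → ℝ :=
  (∑ l ∈ Finset.Ioc 0 i.castSucc, (2 ^ l.val / 2 ^ (i.val + 2) : ℝ)) • bit i.succ

/-- What remains of `fourierPhase i` besides `stagePhase w i` and `targetPhase i`. -/
def residualPhase (w : ℝ) (i : Fin m) : Basis (m + 1) → ℝ :=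
  (1 / 2 ^ (i.val + 2) : ℝ) • value i.castSucc - w • slotPhase i

theorem fourierPhase_eq_add (w : ℝ) :
    (fourierPhase : Fin m → _) = targetPhase + stagePhase w + residualPhase w := by
  funext i
  have h (l : Fin (m + 1)) : (1 / 2 ^ (i.val + 1) : ℝ) • (bit i.succ * (2 ^ l.val : ℝ) • bit l) =
      (2 ^ l.val / 2 ^ (i.val + 2) : ℝ) • bit i.succ -
        (2 ^ l.val / 2 ^ (i.val + 2) : ℝ) • xorBit l i.succ +
        (1 / 2 ^ (i.val + 2) : ℝ) • (2 ^ l.val : ℝ) • bit l := by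
    rw [mul_smul_comm, mul_comm, bit_mul_bit, pow_succ _ (i.val + 1)]
    module
  simp only [fourierPhase, value, Finset.mul_sum, Finset.smul_sum, h, Finset.sum_add_distrib,
    Finset.sum_sub_distrib, Pi.add_apply, targetPhase, stagePhase, residualPhase, Finset.sum_smul]
  abel

theorem dependsOn_targetPhase (i : Fin m) :
    DependsOn (targetPhase i) (Set.Ioc 0 i.castSucc)ᶜ := fun x y h => by
  simp only [targetPhase, Pi.smul_apply, bit, h i.succ fun hi => hi.2.not_gt i.castSucc_lt_succ]

theorem dependsOn_residualPhase (w : ℝ) (i : Fin m) :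
    DependsOn (residualPhase w i) (Set.Iio i.succ) := fun x y h => by
  have hvalue : value i.castSucc x = value i.castSucc y :=
    value_congr fun l hl => h l ((Finset.mem_Ioc.1 hl).2.trans_lt i.castSucc_lt_succ)
  have hslot : slotPhase i x = slotPhase i y := by
    unfold slotPhase
    split_ifs
    · rfl
    · simp only [Pi.smul_apply, bit, h i.castSucc i.castSucc_lt_succ]
  simp only [residualPhase, Pi.sub_apply, Pi.smul_apply, hvalue, hslot]

theorem ladder_fourierPhase (w : ℝ) (j : Fin (m + 1)) :
    ladder fourierPhase j = phase (Fin.partialSum targetPhase j) * ladder (stagePhase w) j *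
      phase (Fin.partialSum (residualPhase w) j) := by
  rw [fourierPhase_eq_add w, ladder_add dependsOn_targetPhase (dependsOn_residualPhase w)]

theorem semiconjBy_ladder_stagePhase_inc (w : ℝ) (j : Fin (m + 1)) :
    SemiconjBy (ladder (stagePhase w) j * phase (Fin.partialSum (residualPhase w) j))
      (ofBasisMap (inc j)) (phase (Fin.partialSum shiftPhase j)) := by
  have h : ladder (stagePhase w) j * phase (Fin.partialSum (residualPhase w) j) =
      phase (-Fin.partialSum targetPhase j) * ladder fourierPhase j := by
    rw [ladder_fourierPhase w, mul_assoc (phase _), ← mul_assoc, ← phase_add, neg_add_cancel,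
      phase_zero, one_mul]
  rw [h]
  exact SemiconjBy.mul_left (commute_phase_phase _ _) (semiconjBy_ladder_fourierPhase_inc j)

theorem partialSum_residualPhase (w : ℝ) (j : Fin (m + 1)) :
    Fin.partialSum (residualPhase w) j =
      Fin.partialSum (residualPhase 0) j - w • Fin.partialSum slotPhase j := by
  induction j using Fin.induction with
  | zero => simp only [Fin.partialSum_zero, smul_zero, sub_zero]
  | succ i ih =>
    simp only [Fin.partialSum_succ, ih, residualPhase]
    module

theorem partialSum_slotPhase (i : Fin m) : Fin.partialSum slotPhase i.succ = value i.castSucc := by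
  cases m with
  | zero => exact i.elim0
  | succ m =>
    induction i using Fin.induction with
    | zero =>
      rw [Fin.partialSum_succ, slotPhase, if_pos (by rfl), Fin.castSucc_zero, value_zero,
        Fin.partialSum_zero, add_zero]
    | succ i ih =>
      rw [Fin.partialSum_succ, ← Fin.succ_castSucc, ih, slotPhase,
        if_neg (Fin.val_ne_zero_iff.2 i.succ_ne_zero), ← Fin.succ_castSucc, value_succ]
      rfl

-- The slots make the residual phases of the ladders with `i` and `i + 1` stages agree.
theorem partialSum_residualPhase_succ (i : Fin m) :
    Fin.partialSum (residualPhase (1 / 2 ^ (i.val + 2))) i.succ =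
      Fin.partialSum (residualPhase 0) i.castSucc := by
  rw [partialSum_residualPhase, partialSum_slotPhase, Fin.partialSum_succ, residualPhase]
  module

theorem realizable_stagePhase {c w : ℝ} {i : Fin m} (hi : i.val ≠ 0)
    (hw : IsPhaseAngle (w * 2 ^ i.val)) (hc : |c| = 1) :
    Realizable 1 (phase (c • stagePhase w i)) := by
  have hmem : i.castSucc ∈ Finset.Ioc 0 i.castSucc :=
    Finset.mem_Ioc.2 ⟨Fin.pos_iff_ne_zero.2 fun h => hi (congrArg Fin.val h), le_rfl⟩
  have hnotMem : i.succ ∉ Finset.Ioc 0 i.castSucc := fun h =>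
    (Finset.mem_Ioc.1 h).2.not_gt i.castSucc_lt_succ
  have ha : ∀ l ∈ Finset.Ioc 0 i.castSucc, IsPhaseAngle (c * -(2 ^ l.val / 2 ^ (i.val + 2))) :=
    fun l hl => (IsPhaseAngle.two_pow_div <| (Fin.le_def.1 (Finset.mem_Ioc.1 hl).2).trans_lt <|
      Nat.lt_add_of_pos_right two_pos).neg.mul_of_abs_eq_one hc
  convert realizable_phase_add_sum_xorBit ha (hw.mul_of_abs_eq_one hc) hnotMem hmem using 2
  simp only [stagePhase, slotPhase, if_neg hi, smul_add, smul_neg, Finset.smul_sum,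
    smul_smul, mul_neg, neg_smul, Finset.sum_neg_distrib, sub_eq_add_neg]

end Stage

/-! ### The general decomposition -/

section Conjugation

variable {W X : Op n} {g p q : Basis n → ℝ}

/-- The diagonal operator with phase `p`, conjugated by `W`. -/
def conjPhase (W : Op n) (p : Basis n → ℝ) : Op n := W⁻¹ * phase p * W

theorem inv_mul_of_isUnit (hW : IsUnit W) : W⁻¹ * W = 1 :=
  Matrix.nonsing_inv_mul W ((Matrix.isUnit_iff_isUnit_det W).1 hW)

theorem conjPhase_add (hW : IsUnit W) (p q : Basis n → ℝ) :
    conjPhase W (p + q) = conjPhase W p * conjPhase W q := by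
  have h : W * W⁻¹ = 1 := Matrix.mul_nonsing_inv W ((Matrix.isUnit_iff_isUnit_det W).1 hW)
  simp only [conjPhase, phase_add, mul_assoc]
  rw [← mul_assoc W, h, one_mul]

theorem conjPhase_mul (W X : Op n) (p : Basis n → ℝ) :
    conjPhase (W * X) p = X⁻¹ * conjPhase W p * X := by
  simp only [conjPhase, Matrix.mul_inv_rev, mul_assoc]

theorem conjPhase_zero (hW : IsUnit W) : conjPhase W 0 = 1 := by
  rw [conjPhase, phase_zero, mul_one, inv_mul_of_isUnit hW]

theorem conjPhase_of_commute (hW : IsUnit W) (h : Commute (phase p) W) :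
    conjPhase W p = phase p := by
  rw [conjPhase, mul_assoc, h.eq, ← mul_assoc, inv_mul_of_isUnit hW, one_mul]

theorem conjPhase_eq_of_semiconjBy (hW : IsUnit W)
    (h : SemiconjBy (W * phase g) X (phase p)) :
    conjPhase W p = phase g * X * (phase g)⁻¹ := by
  have hphase : phase g * (phase g)⁻¹ = 1 := by
    rw [← phase_neg, ← phase_add, add_neg_cancel, phase_zero]
  calc conjPhase W p = W⁻¹ * (phase p * (W * phase g)) * (phase g)⁻¹ := by
        simp only [conjPhase, mul_assoc, hphase, mul_one]
    _ = W⁻¹ * W * (phase g * X) * (phase g)⁻¹ := by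
        rw [← h.eq]
        simp only [mul_assoc]
    _ = phase g * X * (phase g)⁻¹ := by rw [inv_mul_of_isUnit hW, one_mul]

end Conjugation

section Decomposition

variable {m : ℕ}

/-- The part of `Fin.partialSum shiftPhase j` that acts on the digits, alone or jointly with the
control. -/
def digitPhase (j : Fin (m + 1)) : Basis (m + 1) → ℝ :=
  ∑ l ∈ Finset.Ioc 0 j, (1 / 2 ^ l.val : ℝ) • (bit l - xorBit l 0)

theorem partialSum_shiftPhase (j : Fin (m + 1)) :
    Fin.partialSum shiftPhase j = digitPhase j + (1 - 1 / 2 ^ j.val : ℝ) • bit 0 := by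
  induction j using Fin.induction with
  | zero => simp [digitPhase]
  | succ i ih =>
    rw [Fin.partialSum_succ, ih, digitPhase, digitPhase, sum_Ioc_zero_succ, shiftPhase, mul_comm,
      bit_mul_bit, Fin.val_succ, Fin.val_castSucc, pow_succ]
    module

theorem ofBasisMap_inc_last (m : ℕ) :
    ofBasisMap (inc (Fin.last (m + 1))) =
      ofBasisMap (inc (Fin.last m).castSucc) * mct (Fin.last (m + 1)) := by
  have h : Finset.univ.erase (Fin.last (m + 1)) = Finset.Iic (Fin.last m).castSucc := by
    ext l
    rw [Finset.mem_erase, and_iff_left (Finset.mem_univ l), Finset.mem_Iic, Fin.le_castSucc_iff,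
      Fin.succ_last, Fin.lt_last_iff_ne_last]
  rw [← Fin.succ_last, inc_succ, ofBasisMap_comp, Fin.succ_last, mct, h]
  rfl

theorem commute_phase_mct {g : Basis n → ℝ} {t : Fin n} (hg : DependsOn g {t}ᶜ) :
    Commute (phase g) (mct t) := by
  have h : (g ∘ fun y => Function.update y t (y t + ∏ j ∈ Finset.univ.erase t, y j)) = g :=
    funext fun y => hg fun i hi => Function.update_of_ne hi _ _
  rw [Commute, SemiconjBy, mct, phase_mul_ofBasisMap, h]

theorem mct_last_eq_conjPhase_mul_conjPhase (m : ℕ) : mct (Fin.last (m + 1)) =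
    conjPhase (ladder (stagePhase 0) (Fin.last m).castSucc)
        (-Fin.partialSum shiftPhase (Fin.last m).castSucc) *
      conjPhase (ladder (stagePhase (1 / 2 ^ (m + 2))) (Fin.last (m + 1)))
        (Fin.partialSum shiftPhase (Fin.last (m + 1))) := by
  set g := Fin.partialSum (residualPhase (m := m + 1) 0) (Fin.last m).castSucc with hg
  have hres : Fin.partialSum (residualPhase (1 / 2 ^ (m + 2))) (Fin.last (m + 1)) = g :=
    partialSum_residualPhase_succ (Fin.last m)
  have hcomm : Commute (phase g)⁻¹ (mct (Fin.last (m + 1))) := by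
    rw [← hres, ← phase_neg]
    refine commute_phase_mct fun x y h => congrArg Neg.neg ?_
    exact dependsOn_partialSum (dependsOn_residualPhase _) _ fun l hl => h l hl.ne
  have hV := isUnit_ladder (φ := stagePhase 0) (Fin.last m).castSucc
  have hU := isUnit_ladder (φ := stagePhase (1 / 2 ^ (m + 2))) (Fin.last (m + 1))
  have hlow := conjPhase_eq_of_semiconjBy hV (semiconjBy_ladder_stagePhase_inc 0 _)
  rw [← hg] at hlow
  have hhigh := conjPhase_eq_of_semiconjBy hU (semiconjBy_ladder_stagePhase_inc _ _)
  rw [hres, ofBasisMap_inc_last, ← mul_assoc, mul_assoc, ← hcomm.eq, ← mul_assoc, ← hlow]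
    at hhigh
  rw [hhigh, ← mul_assoc, ← conjPhase_add hV, neg_add_cancel, conjPhase_zero hV, one_mul]

theorem conjPhase_ladder_smul_bit_zero (φ : Fin m → Basis (m + 1) → ℝ) (j : Fin (m + 1)) (c : ℝ) :
    conjPhase (ladder φ j) (c • bit 0) = phase (c • bit 0) :=
  conjPhase_of_commute (isUnit_ladder j) <| commute_phase_ladder fun x y h => by
    simp only [Pi.smul_apply, bit, h 0 fun h0 => h0.1.false]

-- The phases on the control in the two factors nearly cancel.
theorem mct_last_eq (m : ℕ) : mct (Fin.last (m + 1)) =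
    conjPhase (ladder (stagePhase 0) (Fin.last m).castSucc) (-digitPhase (Fin.last m).castSucc) *
      conjPhase (ladder (stagePhase (1 / 2 ^ (m + 2))) (Fin.last (m + 1)))
        (digitPhase (Fin.last (m + 1)) + (1 / 2 ^ (m + 1) : ℝ) • bit 0) := by
  have hV := isUnit_ladder (φ := stagePhase 0) (Fin.last m).castSucc
  have hU := isUnit_ladder (φ := stagePhase (1 / 2 ^ (m + 2))) (Fin.last (m + 1))
  rw [mct_last_eq_conjPhase_mul_conjPhase, partialSum_shiftPhase, partialSum_shiftPhase, neg_add,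
    ← neg_smul, conjPhase_add hV, conjPhase_ladder_smul_bit_zero,
    ← conjPhase_ladder_smul_bit_zero (stagePhase (1 / 2 ^ (m + 2))) (Fin.last (m + 1)), mul_assoc,
    ← conjPhase_add hU]
  congr 2
  simp only [Fin.val_last, Fin.val_castSucc, pow_succ]
  module

theorem realizable_digitPhase {b c : ℝ} {j : Fin (m + 1)} (hj : 0 < j) (hb : IsPhaseAngle b)
    (hc : |c| = 1) : Realizable 2 (phase (c • digitPhase j + b • bit 0)) := by
  have ha : ∀ l ∈ Finset.Ioc 0 j, IsPhaseAngle (c * (1 / 2 ^ l.val)) := fun l hl => by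
    simpa using (IsPhaseAngle.two_pow_div (l := 0) (Finset.mem_Ioc.1 hl).1).mul_of_abs_eq_one hc
  have hzero : (0 : Fin (m + 1)) ∉ Finset.Ioc 0 j := Finset.left_notMem_Ioc
  rw [digitPhase, Finset.smul_sum]
  simp only [smul_smul]
  exact realizable_phase_sum_bit_sub_xorBit ha hb hzero ⟨j, Finset.right_mem_Ioc.2 hj⟩

theorem Realizable.conjPhase_ladder_succ {d e : ℕ} {φ : Fin m → Basis (m + 1) → ℝ}
    {p : Basis (m + 1) → ℝ} {i : Fin m} (hp : Realizable d (conjPhase (ladder φ i.castSucc) p))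
    (hφ : Realizable e (phase (φ i))) (hneg : Realizable e (phase (-φ i))) :
    Realizable (d + 2 * e) (conjPhase (ladder φ i.succ) p) := by
  rw [ladder_succ, conjPhase_mul, Matrix.mul_inv_rev, had_inv, ← phase_neg,
    show d + 2 * e = 0 + e + d + (e + 0) by ring]
  exact (((realizable_had _).mul hneg).mul hp).mul (hφ.mul (realizable_had _))

theorem Realizable.conjPhase_ladder_stagePhase {d : ℕ} {w : ℝ} {p : Basis (m + 1) → ℝ}
    (hp : Realizable d (phase p)) (hw : ∀ i : Fin m, IsPhaseAngle (w * 2 ^ i.val))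
    (j : Fin (m + 1)) :
    Realizable (d + 2 * (j.val - 1)) (conjPhase (ladder (stagePhase w) j) p) := by
  induction j using Fin.induction with
  | zero => rwa [ladder_zero, conjPhase_of_commute isUnit_one (Commute.one_right _)]
  | succ i ih =>
    by_cases hi : i.val = 0
    · have hstage : stagePhase w i = 0 := by
        have : i.castSucc = 0 := Fin.ext hi
        simp [stagePhase, slotPhase, hi, this]
      simpa [hi] using ih.conjPhase_ladder_succ (e := 0)
        (by rw [hstage, phase_zero]; exact realizable_one)
        (by rw [hstage, neg_zero, phase_zero]; exact realizable_one)
    · convert ih.conjPhase_ladder_succ (e := 1) ?_ ?_ using 1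
      · rw [Fin.val_succ, Fin.val_castSucc]
        omega
      · simpa using realizable_stagePhase hi (hw i) (c := 1) (by simp)
      · simpa using realizable_stagePhase hi (hw i) (c := -1) (by simp)

theorem realizable_mct_last {m : ℕ} (hm : m ≠ 0) :
    Realizable (4 * m + 2) (mct (Fin.last (m + 1))) := by
  have hlast : 0 < (Fin.last m).castSucc := Fin.lt_def.2 (Nat.pos_of_ne_zero hm)
  have hcontrol : IsPhaseAngle (1 / 2 ^ (m + 1)) := by
    simpa using IsPhaseAngle.two_pow_div (Nat.succ_pos m)
  have hslot (i : Fin (m + 1)) : IsPhaseAngle (1 / 2 ^ (m + 2) * 2 ^ i.val) := by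
    rw [one_div_mul_eq_div]
    exact IsPhaseAngle.two_pow_div (i.isLt.trans (Nat.lt_succ_self _))
  have hlow : Realizable 2 (phase (-digitPhase (Fin.last m).castSucc)) := by
    simpa using realizable_digitPhase hlast .zero (c := -1) (by simp)
  have hhigh : Realizable 2 (phase (digitPhase (Fin.last (m + 1)) +
      (1 / 2 ^ (m + 1) : ℝ) • bit 0)) := by
    simpa using realizable_digitPhase (Fin.last_pos) hcontrol (c := 1) (by simp)
  rw [mct_last_eq]
  refine ((hlow.conjPhase_ladder_stagePhase (fun i => ?_) _).mul
    (hhigh.conjPhase_ladder_stagePhase hslot _)).mono ?_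
  · simpa using IsPhaseAngle.zero
  · simp only [Fin.val_castSucc, Fin.val_last]
    omega

end Decomposition

/-- The phase depth of the circuits constructed for the multi-controlled Toffoli gate on
`n ≥ 4` qubits. -/
def mctDepth (n : ℕ) : ℕ := if n = 4 then 7 else if n = 5 then 13 else 4 * n - 6

theorem realizable_mct_mctDepth {m : ℕ} (hm : 2 ≤ m) :
    Realizable (mctDepth (m + 2)) (mct (Fin.last (m + 1))) := by
  unfold mctDepth
  split_ifs with h₄ h₅
  · obtain rfl : m = 2 := by omega
    exact (realizable_mct_four _).mono (by norm_num)
  · obtain rfl : m = 3 := by omega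
    exact (realizable_mct_five _).mono (by norm_num)
  · exact (realizable_mct_last (by omega)).mono (by omega)

theorem exists_circuit_mct (hn : 4 ≤ n) {t : Fin n} (ht : t.val = n - 1) :
    ∃ C : Circuit n, C.toOp = mct t ∧ C.phaseDepth = mctDepth n := by
  obtain ⟨m, rfl⟩ : ∃ m, n = m + 2 := ⟨n - 2, by omega⟩
  obtain rfl : t = Fin.last (m + 1) := Fin.ext ht
  obtain ⟨C, hop, hdepth⟩ := realizable_mct_mctDepth (m := m) (by omega)
  obtain ⟨C', hop', hdepth'⟩ := hdepth.exists_phaseDepth_eq le_rfl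
    (by unfold mctDepth; split_ifs <;> omega) 0
  exact ⟨C', hop'.trans hop, hdepth'⟩

end CliffordZN

end

theorem theorem3 :
    ∃ C : (n : ℕ) → CliffordZN.Circuit n,
      (∀ (n : ℕ) (hn : 4 ≤ n),
        (C n).toOp = CliffordZN.mct (⟨n - 1, by omega⟩ : Fin n) ∧
        (n = 4 → (C n).phaseDepth = 7) ∧
        (n = 5 → (C n).phaseDepth = 13) ∧
        (6 ≤ n → (C n).phaseDepth = 4 * n - 6)) ∧
      (fun n : ℕ => ((C n).phaseDepth : ℝ)) =O[Filter.atTop] (fun n : ℕ => (n : ℝ)) := by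
  choose C hop hdepth using fun (n : ℕ) (hn : 4 ≤ n) =>
    CliffordZN.exists_circuit_mct hn (t := ⟨n - 1, by omega⟩) rfl
  have hC (n : ℕ) (hn : 4 ≤ n) : (if h : 4 ≤ n then C n h else []) = C n hn := dif_pos hn
  refine ⟨fun n => if h : 4 ≤ n then C n h else [], fun n hn => ?_, ?_⟩
  · simp only [hC n hn, hdepth, CliffordZN.mctDepth]
    exact ⟨hop n hn, by split_ifs <;> omega⟩
  · refine Asymptotics.IsBigO.of_bound 4 ?_
    filter_upwards [Filter.eventually_ge_atTop 6] with n hn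
    rw [hC n (by omega), hdepth, CliffordZN.mctDepth, if_neg (by omega), if_neg (by omega),
      Real.norm_natCast, Real.norm_natCast]
    exact_mod_cast Nat.sub_le _ _
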